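/- All spaces are completely regular and Hausdorff. For a space $X$, let $P(X)$ be the set of Radon probability measures on $X$, i.e. Borel probability measures $\mu$ with $\mu(B)=\sup\{\mu(K): K\subset B,\ K \text{ compact}\}$ for every Borel set $B\subset X$, endowed with the weak topology, i.e. the coarsest topology making $\mu\mapsto\int g\,d\mu$ continuous for every bounded continuous $g:X\to\mathbb R$. Let $\mathcal C(X)$ be the family of nonempty compact subsets of $X$. A map $\varphi:Z\to\mathcal C(X)$ on a space $Z$ is called usco if $\{z\in Z:\varphi(z)\subset V\}$ is open in $Z$ for every open $V\subset X$. An open sieve on $X$ consists of indexed open covers $\{U_a: a\in A_n\}$ of $X$ and maps $\pi_n:A_{n+1}\to A_n$ ($n=0,1,2,\dots$) such that $U_a=\bigcup\{U_b: b\in\pi_n^{-1}(a)\}$ for all $n$ and $a\in A_n$. It is complete if, whenever $a_n\in A_n$ satisfy $\pi_n(a_{n+1})=a_n$ for all $n$, every proper filter on $X$ containing all the sets $U_{a_n}$ has a cluster point in $X$. A space is sieve-complete if it has a complete open sieve. Theorem. Let $X$ be a sieve-complete space and let $Z\subset P(X)$ be a paracompact subspace. Then for every $\varepsilon>0$ there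 is an usco map $\varphi:Z\to\mathcal C(X)$ such that $\mu(X\setminus\varphi(\mu))<\varepsilon$ for every $\mu\in Z$. In particular, every sieve-complete space $X$ is Prohorov: for every compact $T\subset P(X)$ and every $\varepsilon>0$ there is a compact $K\subset X$ with $\mu(X\setminus K)<\varepsilon$ for all $\mu\in T$. -/

import Mathlib

open Set Filter Topology MeasureTheory

universe u

/-- An open sieve on `X`: a sequence of indexed open covers `{U n a : a ∈ A n}` of `X` together
with maps `π n : A (n + 1) → A n` such that each `U n a` is the union of the sets `U (n + 1) b`
over all `b` lying above `a`. -/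
structure OpenSieve (X : Type u) [TopologicalSpace X] where
  A : ℕ → Type u
  π : ∀ n, A (n + 1) → A n
  U : ∀ n, A n → Set X
  isOpen_U : ∀ n a, IsOpen (U n a)
  cover : ∀ n, ⋃ a, U n a = univ
  refine_eq : ∀ n a, U n a = ⋃ b ∈ π n ⁻¹' {a}, U (n + 1) b

/-- An open sieve is complete if for every chain `a n = π n (a (n + 1))`, every proper filter
containing all the sets `U n (a n)` has a cluster point in `X`. (As the sets `U n (a n)` decrease,
it makes no difference whether one asks this of the filters that contain them or of the filters
that merely mesh with them.) -/
def OpenSieve.IsComplete {X : Type u} [TopologicalSpace X] (S : OpenSieve X) : Prop :=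
  ∀ a : ∀ n, S.A n, (∀ n, S.π n (a (n + 1)) = a n) →
    ∀ F : Filter X, F.NeBot → (∀ n, S.U n (a n) ∈ F) → ∃ x, ClusterPt x F

/-- A space is sieve-complete if it has a complete open sieve. -/
def SieveComplete (X : Type u) [TopologicalSpace X] : Prop :=
  ∃ S : OpenSieve X, S.IsComplete

/-- The space `P(X)` of Radon probability measures: Borel probability measures that are inner
regular with respect to compact sets on all Borel sets. As a subtype of `ProbabilityMeasure X` it
carries the weak topology, the coarsest one making `μ ↦ ∫ g dμ` continuous for all bounded
continuous `g`. -/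
abbrev RadonProb (X : Type u) [TopologicalSpace X] [MeasurableSpace X] : Type u :=
  {μ : ProbabilityMeasure X // (μ : Measure X).InnerRegular}

/-- A map into the nonempty compact subsets of `X` is usco if it is upper semicontinuous as a
set-valued map, i.e. if `{z | φ z ⊆ V}` is open for every open `V`. -/
def IsUsco {Z X : Type*} [TopologicalSpace Z] [TopologicalSpace X]
    (φ : Z → TopologicalSpace.NonemptyCompacts X) : Prop :=
  UpperHemicontinuous fun z => (φ z : Set X)

/-- A space is Prohorov if every compact set of Radon probability measures is uniformly tight. -/
def IsProhorovSpace (X : Type u) [TopologicalSpace X] [MeasurableSpace X] [BorelSpace X] : Prop :=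
  ∀ T : Set (RadonProb X), IsCompact T → ∀ ε : ℝ, 0 < ε →
    ∃ K : Set X, IsCompact K ∧ ∀ μ ∈ T, (μ.1 : Measure X) Kᶜ < ENNReal.ofReal ε

open TopologicalSpace
open scoped NNReal ENNReal BoundedContinuousFunction

/-! Fix `r = 1 - δ`. If an open `E` has measure above `r` at a parameter `z`, inner regularity gives
a compact subset of measure above `r`, hence a smaller open set with closure in `E`, covered by
finitely many sieve members. By lower semicontinuity it keeps measure above `r` near `z`. No mass is
lost from one level to the next, so no `ε / 2 ^ n` is needed. Paracompactness makes these choices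
locally finite on closed sets of parameters (`exists_nodes`, `exists_tree`). At `z`, the finitely
many closures of level `n` unite to a closed set, decreasing in `n` and upper semicontinuous in `z`.
By König's lemma and completeness of the sieve the intersection is compact and still usco; by
continuity from above it has measure at least `r`. -/

/-- König's lemma for an inverse sequence of nonempty finite sets. -/
theorem exists_seq_proj_of_finite {A : ℕ → Type u} (π : ∀ n, A (n + 1) → A n)
    (B : ∀ n, Set (A n)) (hfin : ∀ n, (B n).Finite) (hne : ∀ n, (B n).Nonempty)
    (hB : ∀ n, ∀ b ∈ B (n + 1), π n b ∈ B n) :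
    ∃ a : ∀ n, A n, (∀ n, a n ∈ B n) ∧ ∀ n, π n (a (n + 1)) = a n := by
  let f : ∀ n, (B (n + 1)) → (B n) := fun n b => ⟨π n b, hB n b b.2⟩
  let G : CategoryTheory.Functor (Opposite ℕ) (Type u) := CategoryTheory.Functor.ofOpSequence
    (X := fun n => (B n : Type u)) (fun n => TypeCat.ofHom (f n))
  have hG : ∀ j : Opposite ℕ, Finite (G.obj j) := fun j => (hfin j.unop).to_subtype
  have hG' : ∀ j : Opposite ℕ, Nonempty (G.obj j) := fun j => (hne j.unop).to_subtype
  obtain ⟨s, hs⟩ := nonempty_sections_of_finite_inverse_system G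
  refine ⟨fun n => (s ⟨n⟩ : B n).1, fun n => (s ⟨n⟩ : B n).2, fun n => ?_⟩
  have h := hs (CategoryTheory.homOfLE (Nat.le_add_right n 1)).op
  rw [CategoryTheory.Functor.ofOpSequence_map_homOfLE_succ] at h
  exact congrArg Subtype.val h

/-- In a paracompact regular space, a closed set covered by open sets is covered by a locally finite
family of closed sets refining the cover, indexed by the points of the closed set. -/
theorem exists_locallyFinite_closed_refinement {Z : Type*} [TopologicalSpace Z]
    [ParacompactSpace Z] [RegularSpace Z] {D : Set Z} (hD : IsClosed D) (O : D → Set Z)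
    (hO : ∀ z, IsOpen (O z)) (hzO : ∀ z : D, (z : Z) ∈ O z) :
    ∃ C : D → Set Z, (∀ z, IsClosed (C z)) ∧ LocallyFinite C ∧ (∀ z, C z ⊆ O z) ∧
      ⋃ z, C z = D := by
  have h : ∀ z : D, ∃ u : Set Z, IsOpen u ∧ (z : Z) ∈ u ∧ closure u ⊆ O z := fun z => by
    obtain ⟨u, ⟨hzu, hu⟩, huO⟩ := (nhds_basis_opens (z : Z)).nhds_closure.mem_iff.1
      ((hO z).mem_nhds (hzO z))
    exact ⟨u, hu, hzu, huO⟩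
  choose u hu hzu huO using h
  obtain ⟨v, -, hDv, hvf, hvu⟩ := precise_refinement_set hD u hu
    fun z hz => mem_iUnion.2 ⟨⟨z, hz⟩, hzu ⟨z, hz⟩⟩
  refine ⟨fun z => D ∩ closure (v z), fun z => hD.inter isClosed_closure,
    hvf.closure.subset fun z => inter_subset_right,
    fun z => inter_subset_right.trans ((closure_mono (hvu z)).trans (huO z)), ?_⟩
  refine Subset.antisymm (iUnion_subset fun z => inter_subset_left) fun z hz => ?_
  obtain ⟨i, hi⟩ := mem_iUnion.1 (hDv hz)
  exact mem_iUnion.2 ⟨i, hz, subset_closure hi⟩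

/-! ### Semicontinuity and regularity of the weak topology -/

/-- In a completely regular space, a compact set can be separated by a continuous function from the
complement of an open neighbourhood. -/
theorem exists_boundedContinuous_indicator_le {X : Type*} [TopologicalSpace X] [T35Space X]
    {K V : Set X} (hK : IsCompact K) (hV : IsOpen V) (hKV : K ⊆ V) :
    ∃ f : X →ᵇ ℝ≥0, (∀ x, K.indicator 1 x ≤ f x) ∧ ∀ x, f x ≤ V.indicator 1 x := by
  -- Urysohn's lemma applies in the Stone–Čech compactification, where the image of `K` is closed.
  obtain ⟨W, hW, rfl⟩ := isInducing_stoneCechUnit.isOpen_iff.1 hV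
  obtain ⟨f, hf0, hf1, hf⟩ := exists_continuous_zero_one_of_isClosed hW.isClosed_compl
    (hK.image continuous_stoneCechUnit).isClosed
    (by rw [Set.disjoint_left]; rintro _ h ⟨x, hx, rfl⟩; exact h (hKV hx))
  refine ⟨BoundedContinuousFunction.mkOfBound
    ⟨fun x => (f (stoneCechUnit x)).toNNReal,
      continuous_real_toNNReal.comp (f.continuous.comp continuous_stoneCechUnit)⟩ 1 fun x y => ?_,
    fun x => ?_, fun x => ?_⟩
  · have hx := hf (stoneCechUnit x)
    have hy := hf (stoneCechUnit y)
    simp only [ContinuousMap.coe_mk, NNReal.dist_eq, Real.coe_toNNReal _ hx.1,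
      Real.coe_toNNReal _ hy.1, abs_le]
    constructor <;> linarith [hx.1, hx.2, hy.1, hy.2]
  · by_cases hx : x ∈ K
    · have : f (stoneCechUnit x) = 1 := hf1 (mem_image_of_mem _ hx)
      simp [hx, this]
    · simp [hx]
  · by_cases hx : x ∈ stoneCechUnit ⁻¹' W
    · simpa [hx] using (hf (stoneCechUnit x)).2
    · have : f (stoneCechUnit x) = 0 := hf0 hx
      simp [this]

/-- On the space of Radon probability measures over a completely regular space, the measure of an
open set is lower semicontinuous. -/
theorem RadonProb.isOpen_setOf_lt_measure {X : Type u} [TopologicalSpace X] [T35Space X]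
    [MeasurableSpace X] [BorelSpace X] {V : Set X} (hV : IsOpen V) (r : ℝ≥0∞) :
    IsOpen {μ : RadonProb X | r < (μ.1 : Measure X) V} := by
  refine isOpen_iff_mem_nhds.2 fun μ hμ => ?_
  have := μ.2
  -- With `f` between the indicators of `K` and `V`, `r < μ K ≤ ∫ f dμ`; nearby `ν` satisfy `r < ∫ f
  -- dν ≤ ν V`.
  obtain ⟨K, hKV, hK, hrK⟩ := hV.measurableSet.exists_lt_isCompact hμ
  obtain ⟨f, hKf, hfV⟩ := exists_boundedContinuous_indicator_le hK hV hKV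
  have hc : Continuous fun ν : RadonProb X =>
      (ν.1.toFiniteMeasure.testAgainstNN f : ℝ≥0∞) :=
    ENNReal.continuous_coe.comp
      ((ProbabilityMeasure.continuous_testAgainstNN_eval f).comp continuous_subtype_val)
  have hrμ : r < (μ.1.toFiniteMeasure.testAgainstNN f : ℝ≥0∞) := by
    refine hrK.trans_le ?_
    rw [FiniteMeasure.testAgainstNN_coe_eq, ← lintegral_indicator_one hK.measurableSet]
    refine lintegral_mono fun x => ?_
    refine le_trans (le_of_eq ?_) (ENNReal.coe_le_coe.2 (hKf x))
    by_cases hx : x ∈ K <;> simp [hx]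
  filter_upwards [hc.continuousAt.eventually (lt_mem_nhds hrμ)] with ν hν
  refine hν.trans_le ?_
  rw [FiniteMeasure.testAgainstNN_coe_eq]
  refine le_trans (lintegral_mono (g := V.indicator 1) fun x => ?_)
    (lintegral_indicator_one hV.measurableSet).le
  refine le_trans (ENNReal.coe_le_coe.2 (hfV x)) (le_of_eq ?_)
  by_cases hx : x ∈ V <;> simp [hx]

/-- The weak topology is initial for evaluations into `ℝ≥0`, and regularity passes to initial
topologies. Closed refinements over `Z` rely on this. -/
instance MeasureTheory.ProbabilityMeasure.instRegularSpace {X : Type*} [TopologicalSpace X]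
    [MeasurableSpace X] [OpensMeasurableSpace X] : RegularSpace (ProbabilityMeasure X) := by
  have h₁ : IsInducing (ProbabilityMeasure.toFiniteMeasure (Ω := X)) := ⟨rfl⟩
  have h₂ : IsInducing (FiniteMeasure.toWeakDualBCNN (Ω := X)) := ⟨rfl⟩
  have h₃ : IsInducing fun (x : WeakDual ℝ≥0 (X →ᵇ ℝ≥0)) (f : X →ᵇ ℝ≥0) => x f := ⟨rfl⟩
  exact (h₃.comp (h₂.comp h₁)).regularSpace

/-! ### Trees of nodes over a sieve -/

namespace OpenSieve

variable {X : Type u} [TopologicalSpace X] {Z : Type*} [TopologicalSpace Z]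

/-- An ultrafilter finer than `F` contains, at each level, one of the finitely many sieve members;
König's lemma threads such members into a chain. -/
theorem IsComplete.exists_clusterPt {S : OpenSieve X} (hS : S.IsComplete) {B : ∀ n, Set (S.A n)}
    (hfin : ∀ n, (B n).Finite) (hB : ∀ n, ∀ b ∈ B (n + 1), S.π n b ∈ B n) {F : Filter X}
    [F.NeBot] (hF : ∀ n, ⋃ b ∈ B n, S.U n b ∈ F) : ∃ x, ClusterPt x F := by
  have hsub : ∀ n b, S.U (n + 1) b ⊆ S.U n (S.π n b) := fun n b => by
    rw [S.refine_eq n (S.π n b)]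
    exact subset_biUnion_of_mem (u := fun b => S.U (n + 1) b) (by simp)
  let 𝒰 := Ultrafilter.of F
  obtain ⟨a, ha, haπ⟩ := exists_seq_proj_of_finite S.π (fun n => {b ∈ B n | S.U n b ∈ 𝒰})
    (fun n => (hfin n).subset (sep_subset _ _))
    (fun n => (Ultrafilter.finite_biUnion_mem_iff (hfin n)).1 (Ultrafilter.of_le F (hF n)))
    (fun n b hb => ⟨hB n b hb.1, mem_of_superset hb.2 (hsub n b)⟩)
  obtain ⟨x, hx⟩ := hS a haπ 𝒰 inferInstance fun n => (ha n).2
  exact ⟨x, hx.mono (Ultrafilter.of_le F)⟩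

variable [MeasurableSpace X]

/-- A closed set `D` of parameters together with an open set `E` of measure greater than `r` for
all parameters in `D`, covered by finitely many members of the `n`-th cover of the sieve. -/
structure Node (S : OpenSieve X) (m : Z → Measure X) (r : ℝ≥0∞) (n : ℕ) where
  D : Set Z
  E : Set X
  F : Finset (S.A n)
  isClosed_D : IsClosed D
  isOpen_E : IsOpen E
  subset_iUnion : E ⊆ ⋃ a ∈ F, S.U n a
  lt_measure : ∀ z ∈ D, r < m z E

variable [BorelSpace X] [RegularSpace X] [ParacompactSpace Z] [RegularSpace Z]

/-- The branching step of the tree: `B` will be the set of indices above those of the parent node.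
-/
theorem exists_nodes (S : OpenSieve X) {m : Z → Measure X} {r : ℝ≥0∞}
    (hreg : ∀ z, (m z).InnerRegular) (hm : ∀ V, IsOpen V → IsOpen {z | r < m z V})
    {n : ℕ} {D : Set Z} (hD : IsClosed D) {E : Set X} (hE : IsOpen E) {B : Set (S.A n)}
    (hEB : E ⊆ ⋃ b ∈ B, S.U n b) (hDE : ∀ z ∈ D, r < m z E) :
    ∃ N : D → Node S m r n, (LocallyFinite fun i => (N i).D) ∧ ⋃ i, (N i).D = D ∧
      ∀ i, closure (N i).E ⊆ E ∧ ((N i).F : Set (S.A n)) ⊆ B := by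
  have h : ∀ z : D, ∃ (V : Set X) (G : Finset (S.A n)), IsOpen V ∧ V ⊆ (⋃ a ∈ G, S.U n a) ∧
      r < m z V ∧ closure V ⊆ E ∧ (G : Set (S.A n)) ⊆ B := fun z => by
    have := hreg z
    obtain ⟨K, hKE, hK, hrK⟩ := hE.measurableSet.exists_lt_isCompact (hDE z z.2)
    obtain ⟨G, hGB, hG, hKG⟩ := hK.elim_finite_subcover_image (fun b _ => S.isOpen_U n b)
      (hKE.trans hEB)
    obtain ⟨V, hV, hKV, hVE⟩ := hK.exists_isOpen_closure_subset
      ((hE.inter (isOpen_biUnion fun b (_ : b ∈ G) => S.isOpen_U n b)).mem_nhdsSet.2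
        (subset_inter hKE hKG))
    refine ⟨V, hG.toFinset, hV, fun x hx => ?_, hrK.trans_le (measure_mono hKV),
      hVE.trans inter_subset_left, by simpa using hGB⟩
    simpa using (hVE (subset_closure hx)).2
  choose V G hV hVG hrV hVE hGB using h
  obtain ⟨C, hC, hCf, hCO, hCD⟩ := exists_locallyFinite_closed_refinement hD
    (fun z => {w | r < m w (V z)}) (fun z => hm _ (hV z)) hrV
  exact ⟨fun z => ⟨C z, V z, G z, hC z, hV z, hVG z, fun w hw => hCO z hw⟩, hCf, hCD,
    fun z => ⟨hVE z, hGB z⟩⟩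

/-- There is a tree of nodes whose levels are locally finite and cover the parameter space, and
along whose branches the closures of the open sets decrease. -/
theorem exists_tree (S : OpenSieve X) {m : Z → Measure X} {r : ℝ≥0∞}
    (hreg : ∀ z, (m z).InnerRegular) (hm : ∀ V, IsOpen V → IsOpen {z | r < m z V})
    (hr : ∀ z, r < m z univ) :
    ∃ T : ∀ n, Set (Node S m r n),
      (∀ n, LocallyFinite fun N : T n => N.1.D) ∧
      (∀ n z, ∃ N ∈ T n, z ∈ N.D) ∧
      ∀ n, ∀ N' ∈ T (n + 1), ∃ N ∈ T n, N'.D ⊆ N.D ∧ closure N'.E ⊆ N.E ∧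
        ∀ b ∈ N'.F, S.π n b ∈ N.F := by
  obtain ⟨N₀, hN₀f, hN₀D, -⟩ := S.exists_nodes hreg hm (n := 0) isClosed_univ isOpen_univ
    (B := univ) (by simp [S.cover]) fun z _ => hr z
  have hstep : ∀ n (N : Node S m r n), ∃ c : N.D → Node S m r (n + 1),
      (LocallyFinite fun i => (c i).D) ∧ ⋃ i, (c i).D = N.D ∧
      ∀ i, closure (c i).E ⊆ N.E ∧ ((c i).F : Set (S.A (n + 1))) ⊆ S.π n ⁻¹' N.F := by
    intro n N
    refine S.exists_nodes hreg hm N.isClosed_D N.isOpen_E (fun x hx => ?_) N.lt_measure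
    obtain ⟨a, ha, hxa⟩ := mem_iUnion₂.1 (N.subset_iUnion hx)
    rw [S.refine_eq] at hxa
    obtain ⟨b, hb, hxb⟩ := mem_iUnion₂.1 hxa
    refine mem_iUnion₂.2 ⟨b, ?_, hxb⟩
    rw [mem_preimage, mem_singleton_iff] at hb
    simpa [hb] using ha
  choose c hcf hcD hc using hstep
  let T : ∀ n, Set (Node S m r n) := fun n =>
    Nat.rec (range N₀) (fun n T => ⋃ N ∈ T, range (c n N)) n
  have hT : ∀ n N', N' ∈ T (n + 1) ↔ ∃ N ∈ T n, ∃ i, c n N i = N' := fun n N' => by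
    simp [T]
  have hsub : ∀ n N i, (c n N i).D ⊆ N.D := fun n N i => by
    rw [← hcD n N]; exact subset_iUnion (fun i => (c n N i).D) i
  have hfin : ∀ n z, ∃ t ∈ 𝓝 z, {N ∈ T n | (N.D ∩ t).Nonempty}.Finite := by
    intro n z
    induction n with
    | zero =>
      obtain ⟨t, ht, hfin⟩ := hN₀f z
      refine ⟨t, ht, (hfin.image N₀).subset ?_⟩
      rintro _ ⟨⟨i, rfl⟩, hi⟩
      exact ⟨i, hi, rfl⟩
    | succ n ih =>
      obtain ⟨t, ht, hfin⟩ := ih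
      choose s hs hsfin using fun N => hcf n N z
      -- A child lies over its parent's parameters, so only children of the finitely many parents
      -- meeting `t` matter.
      refine ⟨t ∩ ⋂ N ∈ {N ∈ T n | (N.D ∩ t).Nonempty}, s N,
        inter_mem ht ((biInter_mem hfin).2 fun N _ => hs N),
        (hfin.biUnion fun N _ => (hsfin N).image (c n N)).subset ?_⟩
      rintro N' ⟨hN', w, hwN', hwt, hws⟩
      obtain ⟨N, hN, i, rfl⟩ := (hT n N').1 hN'
      have hNt : N ∈ {N ∈ T n | (N.D ∩ t).Nonempty} := ⟨hN, w, hsub n N i hwN', hwt⟩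
      exact mem_biUnion hNt ⟨i, ⟨w, hwN', mem_iInter₂.1 hws N hNt⟩, rfl⟩
  refine ⟨T, fun n z => ?_, fun n z => ?_, fun n N' hN' => ?_⟩
  · obtain ⟨t, ht, h⟩ := hfin n z
    refine ⟨t, ht, Finite.of_finite_image (f := Subtype.val) (h.subset ?_)
      Subtype.val_injective.injOn⟩
    rintro _ ⟨N, hN, rfl⟩
    exact ⟨N.2, hN⟩
  · induction n with
    | zero =>
      obtain ⟨i, hi⟩ := mem_iUnion.1 (hN₀D.symm ▸ mem_univ z : z ∈ ⋃ i, (N₀ i).D)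
      exact ⟨N₀ i, ⟨i, rfl⟩, hi⟩
    | succ n ih =>
      obtain ⟨N, hN, hz⟩ := ih
      rw [← hcD n N] at hz
      obtain ⟨i, hi⟩ := mem_iUnion.1 hz
      exact ⟨c n N i, (hT n _).2 ⟨N, hN, i, rfl⟩, hi⟩
  · obtain ⟨N, hN, i, rfl⟩ := (hT n N').1 hN'
    exact ⟨N, hN, hsub n N i, (hc n N i).1, fun b hb => (hc n N i).2 hb⟩

end OpenSieve

/-! ### Usco maps and the theorem -/

/-- A decreasing sequence of upper semicontinuous closed-valued maps such that filters containing
all the values at a point cluster intersects to an upper semicontinuous compact-valued map. -/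
theorem isCompact_and_upperHemicontinuous_iInter {X Z : Type*} [TopologicalSpace X]
    [TopologicalSpace Z] {ψ : ℕ → Z → Set X} (hcl : ∀ n z, IsClosed (ψ n z))
    (hanti : ∀ z, Antitone fun n => ψ n z) (husc : ∀ n z, ∀ᶠ w in 𝓝 z, ψ n w ⊆ ψ n z)
    (hcpt : ∀ z (F : Filter X), F.NeBot → (∀ n, ψ n z ∈ F) → ∃ x, ClusterPt x F) :
    (∀ z, IsCompact (⋂ n, ψ n z)) ∧ UpperHemicontinuous fun z => ⋂ n, ψ n z := by
  refine ⟨fun z F hF hFz => ?_, upperHemicontinuous_iff_forall_isOpen.2 fun z V hV hzV => ?_⟩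
  · obtain ⟨x, hx⟩ := hcpt z F hF fun n =>
      mem_of_superset (le_principal_iff.1 hFz) (iInter_subset _ n)
    exact ⟨x, (isClosed_iInter fun n => hcl n z).closure_eq ▸
      mem_closure_iff_clusterPt.2 (hx.mono hFz), hx⟩
  · have hn : ∃ n, ψ n z ⊆ V := by
      -- Otherwise the closed sets `ψ n z \ V` generate a proper filter, whose cluster point lies in
      -- every `ψ n z` but outside `V`.
      by_contra! hcon
      have hne : (⨅ n, 𝓟 (ψ n z \ V)).NeBot := by
        refine iInf_neBot_of_directed' ?_ fun n => ?_
        · exact Antitone.directed_ge fun i j hij =>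
            principal_mono.2 (sdiff_subset_sdiff_left (hanti z hij))
        · exact principal_neBot_iff.2 (sdiff_nonempty.2 (hcon n))
      have hmem : ∀ n, ψ n z \ V ∈ ⨅ n, 𝓟 (ψ n z \ V) := fun n =>
        mem_iInf_of_mem n (mem_principal_self _)
      obtain ⟨x, hx⟩ := hcpt z _ hne fun n => mem_of_superset (hmem n) sdiff_subset
      have hxn : ∀ n, x ∈ ψ n z \ V := fun n =>
        ((hcl n z).sdiff hV).closure_eq ▸
          mem_closure_iff_clusterPt.2 (hx.mono (le_principal_iff.2 (hmem n)))
      exact (hxn 0).2 (hzV (mem_iInter.2 fun n => (hxn n).1))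
    obtain ⟨n, hn⟩ := hn
    filter_upwards [husc n z] with w hw
    exact (iInter_subset _ n).trans (hw.trans hn)

/-- The image of a compact space under an upper semicontinuous compact-valued map is compact. -/
theorem isCompact_iUnion_of_upperHemicontinuous {X Z : Type*} [TopologicalSpace X]
    [TopologicalSpace Z] [CompactSpace Z] {φ : Z → Set X} (hφ : UpperHemicontinuous φ)
    (hc : ∀ z, IsCompact (φ z)) : IsCompact (⋃ z, φ z) := by
  refine isCompact_of_finite_subcover fun {ι} U hU hcov => ?_
  choose t ht using fun z => (hc z).elim_finite_subcover U hU ((subset_iUnion φ z).trans hcov)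
  have hev : ∀ z, ∀ᶠ w in 𝓝 z, φ w ⊆ ⋃ i ∈ t z, U i := fun z =>
    upperHemicontinuous_iff_forall_isOpen.1 hφ z _ (isOpen_biUnion fun i _ => hU i) (ht z)
  obtain ⟨s, hs⟩ := CompactSpace.elim_nhds_subcover _ hev
  classical
  refine ⟨s.biUnion t, iUnion_subset fun w x hx => ?_⟩
  obtain ⟨z, hz, hw⟩ := mem_iUnion₂.1 (hs.ge (mem_univ w))
  obtain ⟨i, hi, hxi⟩ := mem_iUnion₂.1 ((show φ w ⊆ _ from hw) hx)
  exact mem_iUnion₂.2 ⟨i, Finset.mem_biUnion.2 ⟨z, hz, hi⟩, hxi⟩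

/-- A lower semicontinuous family of Radon measures of total mass greater than `r`, parametrized
by a paracompact regular space, has measure at least `r` on the values of an upper semicontinuous
compact-valued map. -/
theorem OpenSieve.IsComplete.exists_upperHemicontinuous_le_measure {X : Type u}
    [TopologicalSpace X] [RegularSpace X] [MeasurableSpace X] [BorelSpace X] {S : OpenSieve X}
    (hS : S.IsComplete) {Z : Type*} [TopologicalSpace Z] [ParacompactSpace Z] [RegularSpace Z]
    {m : Z → Measure X} [∀ z, IsFiniteMeasure (m z)] {r : ℝ≥0∞}
    (hreg : ∀ z, (m z).InnerRegular) (hm : ∀ V, IsOpen V → IsOpen {z | r < m z V})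
    (hr : ∀ z, r < m z univ) :
    ∃ φ : Z → Set X, (∀ z, IsClosed (φ z)) ∧ (∀ z, IsCompact (φ z)) ∧ UpperHemicontinuous φ ∧
      ∀ z, r ≤ m z (φ z) := by
  obtain ⟨T, hTf, hTcover, hTparent⟩ := S.exists_tree hreg hm hr
  have hfin : ∀ n z, {N ∈ T n | z ∈ N.D}.Finite := fun n z => by
    refine (((hTf n).point_finite z).image Subtype.val).subset ?_
    rintro N ⟨hN, hz⟩
    exact ⟨⟨N, hN⟩, hz, rfl⟩
  let ψ : ℕ → Z → Set X := fun n z => ⋃ N ∈ {N ∈ T n | z ∈ N.D}, closure N.E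
  have hcl : ∀ n z, IsClosed (ψ n z) := fun n z =>
    (hfin n z).isClosed_biUnion fun N _ => isClosed_closure
  have hanti : ∀ z, Antitone fun n => ψ n z := fun z => antitone_nat_of_succ_le fun n => by
    refine iUnion₂_subset fun N' hN' => ?_
    obtain ⟨N, hN, hD, hE, -⟩ := hTparent n N' hN'.1
    exact hE.trans (subset_closure.trans
      (subset_biUnion_of_mem (u := fun N : Node S m r n => closure N.E)
        (show N ∈ {N ∈ T n | z ∈ N.D} from ⟨hN, hD hN'.2⟩)))
  have husc : ∀ n z, ∀ᶠ w in 𝓝 z, ψ n w ⊆ ψ n z := fun n z => by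
    -- By local finiteness and closedness, a node over a point near `z` is also over `z`.
    filter_upwards [(hTf n).eventually_subset (fun N => N.1.isClosed_D) z] with w hw
    exact biUnion_subset_biUnion_left fun N hN => ⟨hN.1, hw (a := ⟨N, hN.1⟩) hN.2⟩
  have hcpt : ∀ z (F : Filter X), F.NeBot → (∀ n, ψ n z ∈ F) → ∃ x, ClusterPt x F := by
    intro z F hF hFψ
    refine hS.exists_clusterPt
      (B := fun n => ⋃ N ∈ {N ∈ T n | z ∈ N.D}, (N.F : Set (S.A n)))
      (fun n => (hfin n z).biUnion fun N _ => N.F.finite_toSet) (fun n b hb => ?_)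
      -- Level `n + 1` is used because the closure of a child's open set lies in the parent's open
      -- set, which the level-`n` members cover; a node's own closure need not be covered by its own
      -- members.
      fun n => mem_of_superset (hFψ (n + 1)) ?_
    · obtain ⟨N', hN', hb⟩ := mem_iUnion₂.1 hb
      obtain ⟨N, hN, hD, -, hF⟩ := hTparent n N' hN'.1
      exact mem_iUnion₂.2 ⟨N, ⟨hN, hD hN'.2⟩, hF b hb⟩
    · refine iUnion₂_subset fun N' hN' x hx => ?_
      obtain ⟨N, hN, hD, hE, -⟩ := hTparent n N' hN'.1
      obtain ⟨a, ha, hxa⟩ := mem_iUnion₂.1 (N.subset_iUnion (hE hx))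
      exact mem_iUnion₂.2 ⟨a, mem_iUnion₂.2 ⟨N, ⟨hN, hD hN'.2⟩, ha⟩, hxa⟩
  obtain ⟨hφc, hφu⟩ := isCompact_and_upperHemicontinuous_iInter hcl hanti husc hcpt
  refine ⟨_, fun z => isClosed_iInter fun n => hcl n z, hφc, hφu, fun z => ?_⟩
  have htend := tendsto_measure_iInter_atTop (μ := m z)
    (fun n => (hcl n z).measurableSet.nullMeasurableSet) (hanti z) ⟨0, measure_ne_top _ _⟩
  refine ge_of_tendsto' htend fun n => ?_
  obtain ⟨N, hN, hz⟩ := hTcover n z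
  exact (N.lt_measure z hz).le.trans (measure_mono (subset_closure.trans
    (subset_biUnion_of_mem (u := fun N : Node S m r n => closure N.E)
      (show N ∈ {N ∈ T n | z ∈ N.D} from ⟨hN, hz⟩))))

theorem theorem3p1 (X : Type u) [TopologicalSpace X] [T35Space X] [MeasurableSpace X]
    [BorelSpace X] (hX : SieveComplete X) :
    (∀ Z : Set (RadonProb X), ParacompactSpace Z → ∀ ε : ℝ, 0 < ε →
      ∃ φ : Z → TopologicalSpace.NonemptyCompacts X, IsUsco φ ∧
        ∀ μ : Z, (μ.1.1 : Measure X) (φ μ : Set X)ᶜ < ENNReal.ofReal ε) ∧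
    IsProhorovSpace X := by
  obtain ⟨S, hS⟩ := hX
  have key : ∀ Z : Set (RadonProb X), ParacompactSpace Z → ∀ ε : ℝ, 0 < ε →
      ∃ φ : Z → TopologicalSpace.NonemptyCompacts X, IsUsco φ ∧
        ∀ μ : Z, (μ.1.1 : Measure X) (φ μ : Set X)ᶜ < ENNReal.ofReal ε := by
    intro Z hZ ε hε
    -- `δ < 1` forces the values to be nonempty; `δ < ε` absorbs the non-strict bound left by the
    -- limit.
    obtain ⟨δ, hδ0, hδ⟩ : ∃ δ : ℝ≥0∞, 0 < δ ∧ δ < min 1 (ENNReal.ofReal ε) :=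
      exists_between (lt_min one_pos (ENNReal.ofReal_pos.2 hε))
    have hδ1 : δ < 1 := hδ.trans_le (min_le_left _ _)
    obtain ⟨φ, hφcl, hφc, hφu, hφm⟩ := hS.exists_upperHemicontinuous_le_measure
      (Z := Z) (m := fun μ => (μ.1.1 : Measure X)) (r := 1 - δ) (fun μ => μ.1.2)
      (fun V hV => (RadonProb.isOpen_setOf_lt_measure hV (1 - δ)).preimage continuous_subtype_val)
      (fun μ => by
        rw [measure_univ]
        exact ENNReal.sub_lt_self ENNReal.one_ne_top one_ne_zero hδ0.ne')
    have hne : ∀ μ, (φ μ).Nonempty := fun μ => by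
      refine nonempty_of_measure_ne_zero (μ := (μ.1.1 : Measure X)) ?_
      exact ((tsub_pos_of_lt hδ1).trans_le (hφm μ)).ne'
    refine ⟨fun μ => ⟨⟨φ μ, hφc μ⟩, hne μ⟩, hφu, fun μ => ?_⟩
    have hc : (μ.1.1 : Measure X) (φ μ)ᶜ ≤ δ := by
      rw [prob_compl_eq_one_sub (hφcl μ).measurableSet]
      exact tsub_le_iff_tsub_le.1 (hφm μ)
    exact hc.trans_lt (hδ.trans_le (min_le_right _ _))
  refine ⟨key, fun T hT ε hε => ?_⟩
  -- Compact spaces are paracompact, so the first part applies to `T`.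
  have : CompactSpace T := isCompact_iff_compactSpace.1 hT
  obtain ⟨φ, hφu, hφ⟩ := key T inferInstance ε hε
  refine ⟨⋃ μ, φ μ, ?_, fun μ hμ => (measure_mono
    (compl_subset_compl.2 (subset_iUnion (fun μ => (φ μ : Set X)) ⟨μ, hμ⟩))).trans_lt (hφ ⟨μ, hμ⟩)⟩
  exact isCompact_iUnion_of_upperHemicontinuous hφu fun μ => (φ μ).isCompact
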